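/- Let $K$ be a field of arbitrary characteristic, let $R=K[X_1,\dots,X_7]$ be the polynomial ring in seven indeterminates, and let $$J=(X_1X_4-X_2X_3,\ X_3X_6-X_4X_5,\ X_1X_6-X_2X_5,\ X_1X_7,\ X_3X_7,\ X_5X_7)\subset R.$$ Then the local cohomology modules satisfy $H^i_J(R)=0$ for all $i\ge 5$. In particular the cohomological dimension $\operatorname{cd} J=\max\{i\mid H^i_J(R)\neq 0\}$ satisfies $\operatorname{cd} J<5$. -/

import Mathlib

open CategoryTheory CategoryTheory.Limits

universe u

/-- The local cohomology module `H^i_I(R)` of the ring `R`, regarded as a module over itself. -/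
noncomputable abbrev localCohomologyOfRing {R : Type u} [CommRing R] (I : Ideal R) (i : ℕ) :
    ModuleCat.{u} R :=
  (localCohomology I i).obj (ModuleCat.of R R)

/-- The cohomological dimension `cd I = max {i | H^i_I(R) ≠ 0}`. The supremum is taken in
`WithBot ℕ∞`: it is `⊥` if all the modules vanish, and `⊤` if nonzero ones occur in arbitrarily
high degrees. -/
noncomputable def cohomologicalDimension {R : Type u} [CommRing R] (I : Ideal R) : WithBot ℕ∞ :=
  sSup {d : WithBot ℕ∞ | ∃ i : ℕ, d = ((i : ℕ∞) : WithBot ℕ∞) ∧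
    ¬ IsZero (localCohomologyOfRing I i)}

/-- The indeterminates `X₁, …, X₇` are `X 0, …, X 6`. The ideal
`(X₁X₄ - X₂X₃, X₃X₆ - X₄X₅, X₁X₆ - X₂X₅, X₁X₇, X₃X₇, X₅X₇)` of `K[X₁, …, X₇]`. -/
noncomputable def idealJ (K : Type u) [Field K] : Ideal (MvPolynomial (Fin 7) K) :=
  let X₁ : MvPolynomial (Fin 7) K := MvPolynomial.X 0
  let X₂ : MvPolynomial (Fin 7) K := MvPolynomial.X 1
  let X₃ : MvPolynomial (Fin 7) K := MvPolynomial.X 2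
  let X₄ : MvPolynomial (Fin 7) K := MvPolynomial.X 3
  let X₅ : MvPolynomial (Fin 7) K := MvPolynomial.X 4
  let X₆ : MvPolynomial (Fin 7) K := MvPolynomial.X 5
  let X₇ : MvPolynomial (Fin 7) K := MvPolynomial.X 6
  Ideal.span {X₁ * X₄ - X₂ * X₃, X₃ * X₆ - X₄ * X₅, X₁ * X₆ - X₂ * X₅,
    X₁ * X₇, X₃ * X₇, X₅ * X₇}

/-! Put `A = (2 × 2 minors, X₇)` and `B = (X₁, X₃, X₅)`. Every minor lies in `B`, so `A * B ≤ J ≤ A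
⊓ B`, and `A ⊔ B = (X₁, X₃, X₅, X₇)`. Thus `A`, `B` and `A ⊔ B` have at most four generators, and
their local cohomology vanishes above degree four. The Mayer-Vietoris piece `H^n_A ⊕ H^n_B → H^n_J →
H^{n+1}_{A ⊔ B}` then gives the vanishing for `J` when `n ≥ 5`.

All of this is done elementwise in `colim Ext^n(R/L, M)`: `ExtColimitVanishes` says that every class
dies on some `R/J^s`. Allowing every `L` that contains a power of `J` absorbs the colon ideals and
intersections met on the way. The two inputs are `ExtColimitVanishes.sup_span_singleton` (one more
generator) and `ExtColimitVanishes.of_mul_le` (Mayer-Vietoris). -/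

/-! ### Comparing the derived-functor `Ext` with `Abelian.Ext` -/

section ExtComparison

open Opposite

universe v w w'

variable {S : Type w} [Ring S] {C : Type w'} [Category.{v} C] [Abelian C] [Linear S C]
  [EnoughProjectives C] [HasExt.{v} C]

/-- Every element of `Ext S C (p + 1)` is represented by an element of `Abelian.Ext` in such a way
that its restriction along `f` vanishes whenever that of the representative does. -/
lemma exists_abelianExt_detecting {X Y : C} (p : ℕ)
    (z : ((Ext S C (p + 1)).obj (op X)).obj Y) :
    ∃ w : Abelian.Ext X Y (p + 1), ∀ (X' : C) (f : X' ⟶ X),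
      (Abelian.Ext.mk₀ f).comp w (zero_add _) = 0 →
        (((Ext S C (p + 1)).map f.op).app Y) z = 0 := by
  let P := projectiveResolution X
  let F := ((linearYoneda S C).obj Y).rightOp
  let K := (F.mapHomologicalComplex (ComplexShape.down ℕ)).obj P.complex
  -- the class of `z` in the homology of `Hom(P, Y)`
  let z' : (K.homology (p + 1)).unop := (P.isoLeftDerivedObj F (p + 1)).inv.unop z
  -- `F` lands in the opposite category, so `homologyι` becomes the quotient map from cocycles to
  -- cohomology, and `ζ` is a cocycle representing `z'`.
  have hepi : Function.Surjective (K.homologyι (p + 1)).unop :=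
    (ModuleCat.epi_iff_surjective _).1 inferInstance
  obtain ⟨ζ, hζ⟩ := hepi z'
  let φ : P.complex.X (p + 1) ⟶ Y := (K.pOpcycles (p + 1)).unop ζ
  have hφ : P.complex.d (p + 2) (p + 1) ≫ φ = 0 := by
    have := congr_arg (fun g => g.unop ζ) (K.d_pOpcycles (p + 2) (p + 1))
    exact this
  refine ⟨P.extMk φ (p + 2) rfl hφ, fun X' f hf => ?_⟩
  let P' := projectiveResolution X'
  let l := ProjectiveResolution.lift f P' P
  let K' := (F.mapHomologicalComplex (ComplexShape.down ℕ)).obj P'.complex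
  let L : K' ⟶ K := (F.mapHomologicalComplex (ComplexShape.down ℕ)).map l
  let φl : ProjectiveResolution.Hom P' P f := ⟨l, by
    simpa using ProjectiveResolution.lift_commutes_zero f P' P⟩
  rw [ProjectiveResolution.mk₀_comp_extMk φ _ _ hφ φl,
    ProjectiveResolution.extMk_eq_zero_iff _ _ _ _ _ p rfl] at hf
  -- Vanishing in `Abelian.Ext` means that the pulled-back cocycle is the coboundary of some `g`.
  obtain ⟨g, hg⟩ := hf
  have hmono : Function.Injective (K'.pOpcycles (p + 1)).unop :=
    (ModuleCat.mono_iff_injective _).1 inferInstance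
  have h1 : (HomologicalComplex.opcyclesMap L (p + 1)).unop ζ =
      (K'.fromOpcycles (p + 1) p).unop g := by
    apply hmono
    have e1 := congr_arg (fun g => g.unop ζ) (HomologicalComplex.p_opcyclesMap L (p + 1))
    have e2 := congr_arg (fun h => h.unop g) (K'.p_fromOpcycles (p + 1) p)
    exact e1.trans (hg.symm.trans e2.symm)
  have h2 : (HomologicalComplex.homologyMap L (p + 1)).unop z' = 0 := by
    have e1 := congr_arg (fun g => g.unop ζ) (HomologicalComplex.homologyι_naturality L (p + 1))
    have e2 := congr_arg (fun h => h.unop g) (K'.homologyι_comp_fromOpcycles (p + 1) p)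
    have e3 := congr_arg (K'.homologyι (p + 1)).unop h1
    rw [← hζ]
    exact e1.trans (e3.trans e2)
  have e := ProjectiveResolution.isoLeftDerivedObj_inv_naturality f P' P l
    (ProjectiveResolution.lift_commutes_zero f P' P) F (p + 1)
  have e' := congr_arg (fun h => h.unop z) e
  have h3 : (P'.isoLeftDerivedObj F (p + 1)).inv.unop (((F.leftDerived (p + 1)).map f).unop z) = 0 :=
    e'.trans h2
  have hinj : Function.Injective (P'.isoLeftDerivedObj F (p + 1)).inv.unop :=
    (ModuleCat.mono_iff_injective _).1 inferInstance
  exact hinj (h3.trans (map_zero _).symm)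

end ExtComparison

lemma mk₀_comp_extClass_comp {C : Type*} [Category* C] [Abelian C] [HasExt C]
    {S' S : ShortComplex C} (hS' : S'.ShortExact) (hS : S.ShortExact) (φ : S' ⟶ S) {Y : C}
    {n m : ℕ} (y : Abelian.Ext S.X₁ Y n) (hm : 1 + n = m) :
    (Abelian.Ext.mk₀ φ.τ₃).comp (hS.extClass.comp y hm) (zero_add m) =
      hS'.extClass.comp ((Abelian.Ext.mk₀ φ.τ₁).comp y (zero_add n)) hm := by
  rw [← Abelian.Ext.comp_assoc _ _ _ (zero_add 1) hm (by lia),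
    ← ShortComplex.ShortExact.extClass_naturality hS' hS φ,
    Abelian.Ext.comp_assoc_of_second_deg_zero]

/-! ### Vanishing of the colimit of Ext modules -/

section

variable {R : Type u} [CommRing R] {M : ModuleCat.{u} R}

/-- The restriction map `Ext^n(R/L, M) ⟶ Ext^n(R/L', M)` for `L' ≤ L`. -/
noncomputable def extRestrict {L' L : Ideal R} (h : L' ≤ L) {n : ℕ}
    (x : Abelian.Ext (ModuleCat.of R (R ⧸ L)) M n) :
    Abelian.Ext (ModuleCat.of R (R ⧸ L')) M n :=
  (Abelian.Ext.mk₀ (ModuleCat.ofHom (Submodule.factor h))).comp x (zero_add n)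

lemma extRestrict_extRestrict {L'' L' L : Ideal R} (h' : L'' ≤ L') (h : L' ≤ L) {n : ℕ}
    (x : Abelian.Ext (ModuleCat.of R (R ⧸ L)) M n) :
    extRestrict h' (extRestrict h x) = extRestrict (h'.trans h) x := by
  simp only [extRestrict, Abelian.Ext.mk₀_comp_mk₀_assoc, ← ModuleCat.ofHom_comp]
  rw [Submodule.factor_comp]

lemma extRestrict_zero {L' L : Ideal R} (h : L' ≤ L) {n : ℕ} :
    extRestrict h (0 : Abelian.Ext (ModuleCat.of R (R ⧸ L)) M n) = 0 := by
  simp [extRestrict]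

lemma extRestrict_eq_zero_of_le {L'' L' L : Ideal R} (h : L' ≤ L) (h' : L'' ≤ L') {n : ℕ}
    {x : Abelian.Ext (ModuleCat.of R (R ⧸ L)) M n} (hx : extRestrict h x = 0) :
    extRestrict (h'.trans h) x = 0 := by
  rw [← extRestrict_extRestrict h' h, hx, extRestrict_zero]

variable (M) in
/-- The colimit of `Ext^n(R/L, M)`, over the ideals `L` that contain a power of `J`, vanishes. -/
def ExtColimitVanishes (J : Ideal R) (n : ℕ) : Prop :=
  ∀ (L : Ideal R) (t : ℕ), J ^ t ≤ L → ∀ x : Abelian.Ext (ModuleCat.of R (R ⧸ L)) M n,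
    ∃ (s : ℕ) (h : J ^ s ≤ L), extRestrict h x = 0

/-- Each element of the colimit comes from a finite stage, and a representative in `Abelian.Ext`
detects that it dies at a later one. This one-way detection replaces an isomorphism between the two
Ext theories. -/
lemma isZero_localCohomology_of_extColimitVanishes {J : Ideal R} {p : ℕ}
    (hJ : ExtColimitVanishes M J (p + 1)) : IsZero ((localCohomology J (p + 1)).obj M) := by
  have hc := localCohomology.hasColimitDiagram.{u, 0} (localCohomology.idealPowersDiagram J) (p + 1)
  let D := localCohomology.diagram (localCohomology.idealPowersDiagram J) (p + 1)
  let c := isColimitOfPreserves ((evaluation _ _).obj M) (colimit.isColimit D)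
  rw [IsZero.iff_id_eq_zero]
  refine c.hom_ext fun j => ?_
  ext z
  obtain ⟨w, hw⟩ := exists_abelianExt_detecting p (S := R) z
  obtain ⟨s, hs, h⟩ := hJ _ j.unop.unop le_rfl w
  let j' : ℕᵒᵖᵒᵖ := .op (.op (max s j.unop.unop))
  let k : j ⟶ j' := (homOfLE (le_max_right s j.unop.unop)).op.op
  have hz := hw _ ((localCohomology.ringModIdeals (localCohomology.idealPowersDiagram J)).map k.unop)
    (extRestrict_eq_zero_of_le hs (Ideal.pow_le_pow_right (le_max_left s _)) h)
  let ι := ((((evaluation _ _).obj M).mapCocone (colimit.cocone D)).ι.app j').hom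
  have e := congr_arg (fun f => f.hom z) ((((evaluation _ _).obj M).mapCocone
    (colimit.cocone D)).w k)
  refine (e.symm.trans ((congr_arg ι hz).trans (map_zero ι)))

lemma extColimitVanishes_bot (n : ℕ) : ExtColimitVanishes M (⊥ : Ideal R) (n + 1) := by
  intro L t ht x
  -- The exponent is 1 because `⊥ ^ 0 = ⊤`; the quotient by `⊥` is `R`, which is projective.
  have h : (⊥ : Ideal R) ^ 1 ≤ L := by simp
  refine ⟨1, h, ?_⟩
  have : Projective (ModuleCat.of R (R ⧸ ((⊥ : Ideal R) ^ 1))) := by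
    rw [pow_one]
    have : Module.Projective R (R ⧸ (⊥ : Ideal R)) :=
      Module.Projective.of_equiv (Submodule.quotEquivOfEqBot (⊥ : Ideal R) rfl).symm
    exact (IsProjective.iff_projective _).1 this
  exact Abelian.Ext.eq_zero_of_projective _

/-! ### Adding one generator -/

/-- The short exact sequence `0 → R/(Q : c) → R/Q → R/L → 0` for `L = Q + (c)`, where the first map
is multiplication by `c`. -/
noncomputable abbrev colonSequence (Q : Ideal R) (c : R) : ShortComplex (ModuleCat.{u} R) where
  X₁ := ModuleCat.of R (R ⧸ Submodule.comap (LinearMap.lsmul R R c) Q)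
  X₂ := ModuleCat.of R (R ⧸ Q)
  X₃ := ModuleCat.of R (R ⧸ (Q ⊔ Ideal.span {c}))
  f := ModuleCat.ofHom (Submodule.mapQ _ _ (LinearMap.lsmul R R c) le_rfl)
  g := ModuleCat.ofHom (Submodule.factor (p := Q) (p' := Q ⊔ Ideal.span {c}) le_sup_left)
  zero := by
    ext
    exact (Submodule.Quotient.mk_eq_zero _).2
      (Ideal.mem_sup_right (Ideal.mul_mem_right _ _ (Ideal.mem_span_singleton_self c)))

lemma colonSequence_shortExact (Q : Ideal R) (c : R) : (colonSequence Q c).ShortExact where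
  exact := by
    rw [ShortComplex.moduleCat_exact_iff]
    intro y hy
    obtain ⟨y, rfl⟩ := Submodule.Quotient.mk_surjective _ y
    obtain ⟨q, hq, z, hz, rfl⟩ := Submodule.mem_sup.1 ((Submodule.Quotient.mk_eq_zero _).1 hy)
    obtain ⟨a, rfl⟩ := Ideal.mem_span_singleton.1 hz
    refine ⟨Submodule.Quotient.mk a, (Submodule.Quotient.eq _).2 ?_⟩
    simpa using hq
  mono_f := by
    rw [ModuleCat.mono_iff_injective, injective_iff_map_eq_zero]
    intro x hx
    obtain ⟨x, rfl⟩ := Submodule.Quotient.mk_surjective _ x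
    exact (Submodule.Quotient.mk_eq_zero _).2
      ((Submodule.Quotient.mk_eq_zero Q (x := c * x)).1 hx)
  epi_g := (ModuleCat.epi_iff_surjective _).2
    (Submodule.factor_surjective (p := Q) (p' := Q ⊔ Ideal.span {c}) le_sup_left)

lemma ExtColimitVanishes.sup_span_singleton [IsNoetherianRing R] {I : Ideal R} {n : ℕ}
    (h₀ : ExtColimitVanishes M I n) (h₁ : ExtColimitVanishes M I (n + 1)) (r : R) :
    ExtColimitVanishes M (I ⊔ Ideal.span {r}) (n + 1) := by
  intro L t ht x
  obtain ⟨s, hs, hx⟩ := h₁ L t ((Ideal.pow_right_mono le_sup_left t).trans ht) x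
  have hr : r ^ t ∈ L :=
    ht (Ideal.pow_mem_pow (Ideal.mem_sup_right (Ideal.mem_span_singleton_self r)) t)
  have hL₁ : I ^ s ⊔ Ideal.span {r ^ t} ≤ L :=
    sup_le hs ((Ideal.span_singleton_le_iff_mem _).2 hr)
  have hE := colonSequence_shortExact (I ^ s) (r ^ t)
  -- Since `x` dies on `R/I^s`, its restriction is the connecting image of a class `β` in degree
  -- `n`, to which `h₀` applies.
  obtain ⟨β, hβ⟩ := Abelian.Ext.contravariant_sequence_exact₃ hE M (extRestrict hL₁ x)
    ((extRestrict_extRestrict le_sup_left hL₁ x).trans hx) (add_comm 1 n)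
  obtain ⟨u, hu, hβu⟩ := h₀ (Submodule.comap (LinearMap.lsmul R R (r ^ t)) (I ^ s)) s
    (fun a ha => Ideal.mul_mem_left _ _ ha) β
  obtain ⟨v, hsv, huv⟩ : ∃ v, s ≤ v ∧ u ≤ v := ⟨max s u, le_max_left _ _, le_max_right _ _⟩
  have hv := (Ideal.pow_le_pow_right huv).trans hu
  have hβv := extRestrict_eq_zero_of_le hu (Ideal.pow_le_pow_right huv) hβu
  -- the saturation of `I ^ v` with respect to `r` is reached at `r ^ m`
  let A : ℕ →o Ideal R :=
    { toFun := fun k => Submodule.comap (LinearMap.lsmul R R (r ^ k)) (I ^ v)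
      monotone' := by
        intro k l hkl a (ha : r ^ k * a ∈ I ^ v)
        change r ^ l * a ∈ I ^ v
        obtain ⟨d, rfl⟩ := Nat.exists_eq_add_of_le hkl
        rw [pow_add, mul_comm (r ^ k), mul_assoc]
        exact Ideal.mul_mem_left _ _ ha }
  obtain ⟨m, hm⟩ := monotone_stabilizes_iff_noetherian.2 (inferInstance : IsNoetherian R R) A
  have hmt : Submodule.comap (LinearMap.lsmul R R (r ^ (m + t))) (I ^ v) ≤
      Submodule.comap (LinearMap.lsmul R R (r ^ m)) (I ^ v) := (hm (m + t) (by lia)).ge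
  have hL₂ : I ^ v ⊔ Ideal.span {r ^ (m + t)} ≤ I ^ s ⊔ Ideal.span {r ^ t} :=
    sup_le_sup (Ideal.pow_le_pow_right hsv)
      (Ideal.span_singleton_le_span_singleton.2 (pow_dvd_pow r (by lia)))
  have hE' := colonSequence_shortExact (I ^ v) (r ^ (m + t))
  -- Compatibility with the middle terms forces multiplication by `r ^ m` on the left. By
  -- stabilization this factors through `R/I^v`, where `β` is already zero.
  let a : (colonSequence (I ^ v) (r ^ (m + t))).X₁ ⟶ ModuleCat.of R (R ⧸ I ^ v) :=
    ModuleCat.ofHom (Submodule.mapQ _ _ (LinearMap.lsmul R R (r ^ m)) hmt)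
  let φ : colonSequence (I ^ v) (r ^ (m + t)) ⟶ colonSequence (I ^ s) (r ^ t) :=
    { τ₁ := a ≫ ModuleCat.ofHom (Submodule.factor hv)
      τ₂ := ModuleCat.ofHom (Submodule.factor (Ideal.pow_le_pow_right hsv))
      τ₃ := ModuleCat.ofHom (Submodule.factor hL₂)
      comm₁₂ := by
        refine ConcreteCategory.hom_ext _ _ fun y => ?_
        obtain ⟨y, rfl⟩ := Submodule.Quotient.mk_surjective _ y
        refine congr_arg (Submodule.Quotient.mk (p := I ^ s)) ?_
        change r ^ t * (r ^ m * y) = r ^ (m + t) * y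
        ring
      comm₂₃ := by
        refine ConcreteCategory.hom_ext _ _ fun y => ?_
        obtain ⟨y, rfl⟩ := Submodule.Quotient.mk_surjective _ y
        rfl }
  have key : extRestrict hL₂ (extRestrict hL₁ x) = 0 := by
    have hτ : (Abelian.Ext.mk₀ φ.τ₁).comp β (zero_add n) = 0 :=
      (Abelian.Ext.mk₀_comp_mk₀_assoc a (ModuleCat.ofHom (Submodule.factor hv)) β).symm.trans
        ((congr_arg (fun y => (Abelian.Ext.mk₀ a).comp y (zero_add n)) hβv).trans
          (Abelian.Ext.comp_zero _ _ _ _ _))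
    rw [← hβ]
    refine (mk₀_comp_extClass_comp hE' hE φ β (add_comm 1 n)).trans ?_
    rw [hτ, Abelian.Ext.comp_zero]
  refine ⟨v + (m + t), Ideal.sup_pow_add_le_pow_sup_pow.trans ?_, ?_⟩
  · rw [Ideal.span_singleton_pow]
    exact hL₂.trans hL₁
  · rw [extRestrict_extRestrict] at key
    exact extRestrict_eq_zero_of_le _
      (Ideal.sup_pow_add_le_pow_sup_pow.trans (by rw [Ideal.span_singleton_pow])) key

/-- The colimit vanishes in degrees above the number of generators of the ideal. -/
lemma extColimitVanishes_span [IsNoetherianRing R] (s : Finset R) {n : ℕ} (hn : s.card < n) :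
    ExtColimitVanishes M (Ideal.span (s : Set R)) n := by
  classical
  induction s using Finset.induction_on generalizing n with
  | empty =>
    obtain ⟨n, rfl⟩ := Nat.exists_eq_add_of_lt hn
    simpa using extColimitVanishes_bot (M := M) n
  | insert a s ha ih =>
    rw [Finset.card_insert_of_notMem ha] at hn
    obtain ⟨n, rfl⟩ := Nat.exists_eq_add_of_le' (Nat.one_le_of_lt hn)
    rw [Finset.coe_insert, Ideal.span_insert, sup_comm]
    exact (ih (by lia)).sup_span_singleton (ih (by lia)) a

/-! ### Mayer-Vietoris -/

/-- The short exact sequence `0 → R/(C ∩ D) → R/C × R/D → R/(C + D) → 0`. -/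
noncomputable abbrev infSupSequence (C D : Ideal R) : ShortComplex (ModuleCat.{u} R) where
  X₁ := ModuleCat.of R (R ⧸ (C ⊓ D))
  X₂ := ModuleCat.of R ((R ⧸ C) × (R ⧸ D))
  X₃ := ModuleCat.of R (R ⧸ (C ⊔ D))
  f := ModuleCat.ofHom ((Submodule.factor inf_le_left).prod (Submodule.factor inf_le_right))
  g := ModuleCat.ofHom ((Submodule.factor le_sup_left).comp (LinearMap.fst R _ _) -
    (Submodule.factor le_sup_right).comp (LinearMap.snd R _ _))
  zero := by
    refine ConcreteCategory.hom_ext _ _ fun y => ?_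
    obtain ⟨y, rfl⟩ := Submodule.Quotient.mk_surjective _ y
    exact sub_self (Submodule.Quotient.mk (p := C ⊔ D) y)

lemma infSupSequence_shortExact (C D : Ideal R) : (infSupSequence C D).ShortExact where
  exact := by
    rw [ShortComplex.moduleCat_exact_iff]
    rintro ⟨a, b⟩ hab
    obtain ⟨a, rfl⟩ := Submodule.Quotient.mk_surjective _ a
    obtain ⟨b, rfl⟩ := Submodule.Quotient.mk_surjective _ b
    obtain ⟨c, hc, d, hd, h⟩ := Submodule.mem_sup.1
      ((Submodule.Quotient.eq (C ⊔ D)).1 (sub_eq_zero.1 hab))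
    refine ⟨Submodule.Quotient.mk (a - c), Prod.ext ((Submodule.Quotient.eq C).2 ?_)
      ((Submodule.Quotient.eq D).2 ?_)⟩
    · simpa using hc
    · have h' : c + d = a - b := h
      have hd' : a - c - b = d := by linear_combination -h'
      exact hd'.symm ▸ hd
  mono_f := by
    rw [ModuleCat.mono_iff_injective, injective_iff_map_eq_zero]
    intro x hx
    obtain ⟨x, rfl⟩ := Submodule.Quotient.mk_surjective _ x
    exact (Submodule.Quotient.mk_eq_zero _).2
      ⟨(Submodule.Quotient.mk_eq_zero C).1 (congr_arg Prod.fst hx),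
        (Submodule.Quotient.mk_eq_zero D).1 (congr_arg Prod.snd hx)⟩
  epi_g := by
    refine (ModuleCat.epi_iff_surjective _).2 fun y => ?_
    obtain ⟨y, rfl⟩ := Submodule.Quotient.mk_surjective _ y
    refine ⟨(Submodule.Quotient.mk y, Submodule.Quotient.mk 0), ?_⟩
    exact (congr_arg (Submodule.Quotient.mk (p := C ⊔ D) y - ·)
      (Submodule.Quotient.mk_zero _)).trans (sub_zero _)

/-- The morphism of short exact sequences induced by `C' ≤ C` and `D' ≤ D`. -/
noncomputable abbrev infSupSequenceMap {C C' D D' : Ideal R} (hC : C' ≤ C) (hD : D' ≤ D) :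
    infSupSequence C' D' ⟶ infSupSequence C D where
  τ₁ := ModuleCat.ofHom (Submodule.factor (inf_le_inf hC hD))
  τ₂ := ModuleCat.ofHom ((Submodule.factor hC).prodMap (Submodule.factor hD))
  τ₃ := ModuleCat.ofHom (Submodule.factor (sup_le_sup hC hD))
  comm₁₂ := by
    refine ConcreteCategory.hom_ext _ _ fun y => ?_
    obtain ⟨y, rfl⟩ := Submodule.Quotient.mk_surjective _ y
    rfl
  comm₂₃ := by
    refine ConcreteCategory.hom_ext _ _ fun ⟨y, z⟩ => ?_
    obtain ⟨y, rfl⟩ := Submodule.Quotient.mk_surjective _ y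
    obtain ⟨z, rfl⟩ := Submodule.Quotient.mk_surjective _ z
    rfl

/-- Artin-Rees: for a suitable `k`, `A^(k+t) ⊓ B^t = A^t (A^k ⊓ B^t) ≤ A^t B^t`. -/
lemma exists_pow_inf_pow_le_mul_pow [IsNoetherianRing R] (A B : Ideal R) (t : ℕ) :
    ∃ a, A ^ a ⊓ B ^ a ≤ (A * B) ^ t := by
  obtain ⟨k, hk⟩ := Ideal.exists_pow_inf_eq_pow_smul A (B ^ t)
  refine ⟨k + t, (inf_le_inf_left _ (Ideal.pow_le_pow_right (Nat.le_add_left t k))).trans ?_⟩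
  have h := hk (k + t) (by lia)
  rw [smul_eq_mul, Ideal.mul_top, Nat.add_sub_cancel_left] at h
  rw [h, mul_pow]
  exact Ideal.mul_mono_right inf_le_right

/-- A consequence of the Mayer-Vietoris sequence. -/
lemma ExtColimitVanishes.of_mul_le [IsNoetherianRing R] {A B J : Ideal R} {n : ℕ}
    (hA : ExtColimitVanishes M A n) (hB : ExtColimitVanishes M B n)
    (hAB : ExtColimitVanishes M (A ⊔ B) (n + 1)) (hJA : J ≤ A) (hJB : J ≤ B) (hJ : A * B ≤ J) :
    ExtColimitVanishes M J n := by
  intro L t ht x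
  obtain ⟨a, ha⟩ := exists_pow_inf_pow_le_mul_pow A B t
  have haL : A ^ a ⊓ B ^ a ≤ L := ha.trans ((Ideal.pow_right_mono hJ t).trans ht)
  have hE := infSupSequence_shortExact (A ^ a) (B ^ a)
  -- The connecting image of `x` dies on a power of `A ⊔ B`. That power contains `A^b ⊔ B^b` for
  -- large `b`, so by naturality `x` restricted to `R/(A^b ⊓ B^b)` extends to a class `w` on the
  -- product.
  obtain ⟨s, hs, hx⟩ := hAB (A ^ a ⊔ B ^ a) (a + a) Ideal.sup_pow_add_le_pow_sup_pow
    (hE.extClass.comp (extRestrict haL x) (add_comm 1 n))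
  obtain ⟨b, hsb, hab⟩ : ∃ b, s ≤ b ∧ a ≤ b := ⟨max s a, le_max_left _ _, le_max_right _ _⟩
  have hE' := infSupSequence_shortExact (A ^ b) (B ^ b)
  have hAab : A ^ b ≤ A ^ a := Ideal.pow_le_pow_right hab
  have hBab : B ^ b ≤ B ^ a := Ideal.pow_le_pow_right hab
  have hbs : A ^ b ⊔ B ^ b ≤ (A ⊔ B) ^ s :=
    (sup_le (Ideal.pow_right_mono le_sup_left b) (Ideal.pow_right_mono le_sup_right b)).trans
      (Ideal.pow_le_pow_right hsb)
  have hbL : A ^ b ⊓ B ^ b ≤ L := (inf_le_inf hAab hBab).trans haL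
  have hδ : hE'.extClass.comp (extRestrict hbL x) (add_comm 1 n) = 0 := by
    rw [← extRestrict_extRestrict (inf_le_inf hAab hBab) haL x]
    exact (mk₀_comp_extClass_comp hE' hE (infSupSequenceMap hAab hBab) _ _).symm.trans
      (extRestrict_eq_zero_of_le hs hbs hx)
  obtain ⟨w, hw⟩ := Abelian.Ext.contravariant_sequence_exact₁ hE' M _ (add_comm 1 n) hδ
  let i₁ : ModuleCat.of R (R ⧸ A ^ b) ⟶ (infSupSequence (A ^ b) (B ^ b)).X₂ :=
    ModuleCat.ofHom (LinearMap.inl R _ _)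
  let i₂ : ModuleCat.of R (R ⧸ B ^ b) ⟶ (infSupSequence (A ^ b) (B ^ b)).X₂ :=
    ModuleCat.ofHom (LinearMap.inr R _ _)
  obtain ⟨s₁, hs₁, hw₁⟩ := hA (A ^ b) b le_rfl ((Abelian.Ext.mk₀ i₁).comp w (zero_add n))
  obtain ⟨s₂, hs₂, hw₂⟩ := hB (B ^ b) b le_rfl ((Abelian.Ext.mk₀ i₂).comp w (zero_add n))
  have key : extRestrict (inf_le_inf hs₁ hs₂) (extRestrict hbL x) = 0 := by
    let p₁ : ModuleCat.of R (R ⧸ (A ^ s₁ ⊓ B ^ s₂)) ⟶ ModuleCat.of R (R ⧸ A ^ s₁) :=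
      ModuleCat.ofHom (Submodule.factor inf_le_left)
    let p₂ : ModuleCat.of R (R ⧸ (A ^ s₁ ⊓ B ^ s₂)) ⟶ ModuleCat.of R (R ⧸ B ^ s₂) :=
      ModuleCat.ofHom (Submodule.factor inf_le_right)
    -- The restricted diagonal is the sum of its two coordinates, so it suffices to kill the
    -- components of `w` on `R/A^b` and `R/B^b` separately.
    have hsum : ModuleCat.ofHom (Submodule.factor (inf_le_inf hs₁ hs₂)) ≫
        (infSupSequence (A ^ b) (B ^ b)).f =
        p₁ ≫ ModuleCat.ofHom (Submodule.factor hs₁) ≫ i₁ +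
          p₂ ≫ ModuleCat.ofHom (Submodule.factor hs₂) ≫ i₂ := by
      refine ConcreteCategory.hom_ext _ _ fun y => ?_
      obtain ⟨y, rfl⟩ := Submodule.Quotient.mk_surjective _ y
      exact Prod.ext (add_zero _).symm (zero_add _).symm
    have e₁ : (Abelian.Ext.mk₀ (p₁ ≫ ModuleCat.ofHom (Submodule.factor hs₁) ≫ i₁)).comp w
        (zero_add n) = 0 := by
      rw [← Abelian.Ext.mk₀_comp_mk₀_assoc, ← Abelian.Ext.mk₀_comp_mk₀_assoc]
      exact (congr_arg (fun y => (Abelian.Ext.mk₀ p₁).comp y (zero_add n)) hw₁).trans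
        (Abelian.Ext.comp_zero _ _ _ _ _)
    have e₂ : (Abelian.Ext.mk₀ (p₂ ≫ ModuleCat.ofHom (Submodule.factor hs₂) ≫ i₂)).comp w
        (zero_add n) = 0 := by
      rw [← Abelian.Ext.mk₀_comp_mk₀_assoc, ← Abelian.Ext.mk₀_comp_mk₀_assoc]
      exact (congr_arg (fun y => (Abelian.Ext.mk₀ p₂).comp y (zero_add n)) hw₂).trans
        (Abelian.Ext.comp_zero _ _ _ _ _)
    rw [← hw]
    refine (Abelian.Ext.mk₀_comp_mk₀_assoc _ _ w).trans ?_
    rw [hsum, Abelian.Ext.mk₀_add, Abelian.Ext.add_comp, e₁, e₂, add_zero]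
  rw [extRestrict_extRestrict] at key
  have hJs : J ^ (max s₁ s₂) ≤ A ^ s₁ ⊓ B ^ s₂ :=
    le_inf ((Ideal.pow_right_mono hJA _).trans (Ideal.pow_le_pow_right (le_max_left _ _)))
      ((Ideal.pow_right_mono hJB _).trans (Ideal.pow_le_pow_right (le_max_right _ _)))
  exact ⟨_, hJs.trans ((inf_le_inf hs₁ hs₂).trans hbL), extRestrict_eq_zero_of_le _ hJs key⟩

/-! ### The ideal `J` -/

lemma extColimitVanishes_minors_sup_mul [IsNoetherianRing R] (x : Fin 7 → R) {n : ℕ}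
    (hn : 5 ≤ n) :
    ExtColimitVanishes M (Ideal.span {x 0 * x 3 - x 1 * x 2, x 2 * x 5 - x 3 * x 4,
      x 0 * x 5 - x 1 * x 4, x 0 * x 6, x 2 * x 6, x 4 * x 6}) n := by
  classical
  -- `S`, `T`, `U` generate `A`, `B`, `A ⊔ B`. The minors are redundant in `A ⊔ B`, which leaves
  -- four generators. Only upper bounds on the cardinalities hold, as the `x i` are arbitrary.
  let S : Finset R :=
    {x 0 * x 3 - x 1 * x 2, x 2 * x 5 - x 3 * x 4, x 0 * x 5 - x 1 * x 4, x 6}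
  let T : Finset R := {x 0, x 2, x 4}
  let U : Finset R := {x 0, x 2, x 4, x 6}
  have hS : S.card ≤ 4 := Finset.card_le_four
  have hT : T.card ≤ 3 := Finset.card_le_three
  have hU : U.card ≤ 4 := Finset.card_le_four
  have h0 : x 0 ∈ Ideal.span (T : Set R) := Ideal.subset_span (by simp [T])
  have h2 : x 2 ∈ Ideal.span (T : Set R) := Ideal.subset_span (by simp [T])
  have h4 : x 4 ∈ Ideal.span (T : Set R) := Ideal.subset_span (by simp [T])
  have h6 : x 6 ∈ Ideal.span (S : Set R) := Ideal.subset_span (by simp [S])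
  have hm1 : x 0 * x 3 - x 1 * x 2 ∈ Ideal.span (T : Set R) :=
    sub_mem (Ideal.mul_mem_right _ _ h0) (Ideal.mul_mem_left _ _ h2)
  have hm2 : x 2 * x 5 - x 3 * x 4 ∈ Ideal.span (T : Set R) :=
    sub_mem (Ideal.mul_mem_right _ _ h2) (Ideal.mul_mem_left _ _ h4)
  have hm3 : x 0 * x 5 - x 1 * x 4 ∈ Ideal.span (T : Set R) :=
    sub_mem (Ideal.mul_mem_right _ _ h0) (Ideal.mul_mem_left _ _ h4)
  have hsup : Ideal.span (S : Set R) ⊔ Ideal.span (T : Set R) = Ideal.span (U : Set R) := by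
    apply le_antisymm
    · have hTU : Ideal.span (T : Set R) ≤ Ideal.span (U : Set R) :=
        Ideal.span_mono (by simp [T, U, Set.insert_subset_iff])
      refine sup_le (Ideal.span_le.2 ?_) hTU
      simp only [S, Finset.coe_insert, Finset.coe_singleton, Set.insert_subset_iff,
        Set.singleton_subset_iff, SetLike.mem_coe]
      exact ⟨hTU hm1, hTU hm2, hTU hm3, Ideal.subset_span (by simp [U])⟩
    · refine Ideal.span_le.2 ?_
      simp only [U, Finset.coe_insert, Finset.coe_singleton, Set.insert_subset_iff,
        Set.singleton_subset_iff, SetLike.mem_coe]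
      exact ⟨Ideal.mem_sup_right h0, Ideal.mem_sup_right h2, Ideal.mem_sup_right h4,
        Ideal.mem_sup_left h6⟩
  refine ExtColimitVanishes.of_mul_le (extColimitVanishes_span S (by lia))
    (extColimitVanishes_span T (by lia)) (hsup ▸ extColimitVanishes_span U (by lia)) ?_ ?_ ?_
  · refine Ideal.span_le.2 ?_
    simp only [Set.insert_subset_iff, Set.singleton_subset_iff, SetLike.mem_coe]
    exact ⟨Ideal.subset_span (by simp [S]), Ideal.subset_span (by simp [S]),
      Ideal.subset_span (by simp [S]), Ideal.mul_mem_left _ _ h6, Ideal.mul_mem_left _ _ h6,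
      Ideal.mul_mem_left _ _ h6⟩
  · refine Ideal.span_le.2 ?_
    simp only [Set.insert_subset_iff, Set.singleton_subset_iff, SetLike.mem_coe]
    exact ⟨hm1, hm2, hm3, Ideal.mul_mem_right _ _ h0, Ideal.mul_mem_right _ _ h2,
      Ideal.mul_mem_right _ _ h4⟩
  · rw [Ideal.span_mul_span', Ideal.span_le]
    rintro _ ⟨a, ha, b, hb, rfl⟩
    simp only [S, Finset.coe_insert, Finset.coe_singleton, Set.mem_insert_iff,
      Set.mem_singleton_iff] at ha
    rcases ha with rfl | rfl | rfl | rfl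
    · exact Ideal.mul_mem_right _ _ (Ideal.subset_span (by simp))
    · exact Ideal.mul_mem_right _ _ (Ideal.subset_span (by simp))
    · exact Ideal.mul_mem_right _ _ (Ideal.subset_span (by simp))
    · simp only [T, Finset.coe_insert, Finset.coe_singleton, Set.mem_insert_iff,
        Set.mem_singleton_iff] at hb
      change x 6 * b ∈ Ideal.span _
      rw [mul_comm (x 6) b]
      rcases hb with rfl | rfl | rfl <;> exact Ideal.subset_span (by simp)

end

theorem mainTheorem3 (K : Type u) [Field K] :
    (∀ i : ℕ, 5 ≤ i → IsZero (localCohomologyOfRing (idealJ K) i)) ∧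
      cohomologicalDimension (idealJ K) < 5 := by
  have h (i : ℕ) (hi : 5 ≤ i) : IsZero (localCohomologyOfRing (idealJ K) i) := by
    obtain ⟨p, rfl⟩ := Nat.exists_eq_add_of_le' (show 1 ≤ i by lia)
    exact isZero_localCohomology_of_extColimitVanishes (extColimitVanishes_minors_sup_mul MvPolynomial.X hi)
  refine ⟨h, lt_of_le_of_lt (b := ((4 : ℕ∞) : WithBot ℕ∞)) (sSup_le ?_) ?_⟩
  · rintro _ ⟨i, rfl, hi⟩
    have : i ≤ 4 := by
      by_contra hi'
      exact hi (h i (by lia))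
    exact_mod_cast this
  · exact WithBot.coe_lt_coe.2 (by norm_num)
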